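/- A vtree for a finite non-empty variable set $X$ is a rooted tree in which every non-leaf node has exactly two children and whose leaves are in one-to-one correspondence with $X$. A complete structured DNNF $(D,T,\lambda)$ is a Boolean circuit $D$ in negation normal form without constants (inputs are literals, $\wedge$-gates have two inputs rooting subcircuits on disjoint variable sets, $\vee$-gates have at least one input), with a vtree $T$ for the variables of $D$, and an assignment of every gate $u$ to exactly one node $t_u$ of $T$ such that: the gates assigned to a leaf labelled $x$ are inputs labelled $x$ or $\neg x$; no input is assigned to a non-leaf node; the two inputs of an $\wedge$-gate $v$ are $\vee$-gates or input gates assigned to two different children of $t_v$; the inputs of an $\vee$-gate $v$ are $\wedge$-gates assigned to $t_v$; the output gate is assigned to the root. It is a d-DNNF (deterministic) if no assignment satisfies two different inputs of the same $\vee$-gate. Its width is the maximum, over the nodes $t$ of $T$, of the number of $\vee$-gates assigned to $t$. **Theorem.** There are constants $C,\varepsilon>0$ such that for every integer $n\ge 1$ there are a variable set $X$ with $|X|\le Cn$, a vtree $T$ for $X$ and complete structured d-DNNFs $D_1,\dots,D_n$ of width $2$, all with vtree $T$, such that 1. $\bigwedge_{i=1}^n D_i$ is computed by some complete structured DNNF,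 and every complete structured DNNF computing it (deterministic or not, with an arbitrary vtree) has width at least $2^{\varepsilon n}$; 2. $\bigvee_{i=1}^n\neg D_i$ is computed by a complete structured DNNF with vtree $T$ of width at most $Cn$, and every complete structured DNNF computing it (with an arbitrary vtree) has width at least $\varepsilon n$. Consequently: 3. (The upper bound $2^w$ on the width of a negation is essentially optimal.) There is $\delta>0$ such that for every integer $w\ge1$ there is a complete structured DNNF $E$ of width at most $w$ such that $\neg E$ is computed by some complete structured DNNF, and every complete structured DNNF computing $\neg E$ has width at least $2^{\delta w}$. 4. (Unbounded conjunction and disjunction are not width-bounded.) There is a constant $B$ such that for every $K$ there are an $n$ and complete structured d-DNNFs $D_1,\dots,D_n$ of width at most $B$ with a common vtree such that $\bigwedge_{i=1}^n D_i$ is computed by some complete structured DNNF, but only by ones of width greater than $K$. The same holds for $\bigvee_{i=1}^n D_i$. -/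

import Mathlib

/-! ### Vtrees -/

/-- Rooted binary trees in which every non-leaf node has exactly two children and whose leaves are
labelled with variables from `V`. -/
inductive VTree (V : Type) : Type
  | leaf (x : V) : VTree V
  | node (l r : VTree V) : VTree V
  deriving DecidableEq

namespace VTree

variable {V : Type}

/-- The labels of the leaves, from left to right. -/
def leaves : VTree V → List V
  | leaf x => [x]
  | node l r => l.leaves ++ r.leaves

/-- The nodes of `T`. A node is identified with the subtree rooted in it; when the leaves carry
pairwise different variables (see `IsVTreeFor`), different nodes have different subtrees. -/
def nodes [DecidableEq V] : VTree V → Finset (VTree V)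
  | leaf x => {leaf x}
  | node l r => insert (node l r) (l.nodes ∪ r.nodes)

/-- `s` is a child of `t`. -/
def IsChild (s : VTree V) : VTree V → Prop
  | leaf _ => False
  | node l r => s = l ∨ s = r

/-- `T` is a vtree for the set of variables `X`: its leaves are in one-to-one correspondence
with `X`. -/
def IsVTreeFor (T : VTree V) (X : Finset V) : Prop :=
  T.leaves.Nodup ∧ ∀ x, x ∈ T.leaves ↔ x ∈ X

end VTree

/-! ### Boolean circuits in negation normal form -/

/-- What a gate of an NNF circuit over the variables `V` is: an input labelled with a literal
(`lit x true` is `x`, `lit x false` is `¬ x`), an `∧`-gate with its two inputs, or an `∨`-gate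
with its set of inputs. -/
inductive GateKind (V G : Type) : Type
  | lit (x : V) (b : Bool) : GateKind V G
  | and (a b : G) : GateKind V G
  | or (S : Finset G) : GateKind V G

namespace GateKind

variable {V G : Type}

def IsLit : GateKind V G → Prop
  | lit _ _ => True
  | _ => False

def IsAnd : GateKind V G → Prop
  | and _ _ => True
  | _ => False

def IsOr : GateKind V G → Prop
  | or _ => True
  | _ => False

/-- `u` is among the inputs of a gate of this kind. -/
def HasInput (u : G) : GateKind V G → Prop
  | lit _ _ => False
  | and a b => u = a ∨ u = b
  | or S => u ∈ S

end GateKind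

/-- A (finite, acyclic) Boolean circuit in negation normal form over the variables `V`, without
constants, with a distinguished output gate. -/
structure NNF (V : Type) where
  Gate : Type
  finite_gate : Finite Gate
  kind : Gate → GateKind V Gate
  or_nonempty : ∀ g S, kind g = GateKind.or S → S.Nonempty
  acyclic : WellFounded fun u v : Gate => (kind v).HasInput u
  output : Gate

namespace NNF

variable {V : Type}

/-- `(u, v)` is an edge of the circuit: `u` is an input of `v`. -/
def Edge (D : NNF V) (u v : D.Gate) : Prop :=
  (D.kind v).HasInput u

/-- The gate `g` evaluates to `1` under the assignment `τ`. -/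
inductive Sat (D : NNF V) (τ : V → Bool) : D.Gate → Prop
  | lit (g : D.Gate) (x : V) (b : Bool) : D.kind g = GateKind.lit x b → τ x = b → Sat D τ g
  | and (g a b : D.Gate) : D.kind g = GateKind.and a b → Sat D τ a → Sat D τ b → Sat D τ g
  | or (g : D.Gate) (S : Finset D.Gate) (h : D.Gate) :
      D.kind g = GateKind.or S → h ∈ S → Sat D τ h → Sat D τ g

/-- The circuit evaluates to `1` under the assignment `τ`. -/
def Eval (D : NNF V) (τ : V → Bool) : Prop :=
  D.Sat τ D.output

/-- The circuit computes the Boolean function `f`. -/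
def Computes (D : NNF V) (f : (V → Bool) → Prop) : Prop :=
  ∀ τ, D.Eval τ ↔ f τ

/-- The variables of the subcircuit rooted in the gate `g`. -/
def varsBelow (D : NNF V) (g : D.Gate) : Set V :=
  {x | ∃ h b, Relation.ReflTransGen D.Edge h g ∧ D.kind h = GateKind.lit x b}

/-- The two inputs of every `∧`-gate root subcircuits on disjoint sets of variables. -/
def Decomposable (D : NNF V) : Prop :=
  ∀ g a b, D.kind g = GateKind.and a b → Disjoint (D.varsBelow a) (D.varsBelow b)

/-- No assignment makes two different inputs of an `∨`-gate true. -/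
def Deterministic (D : NNF V) : Prop :=
  ∀ g S, D.kind g = GateKind.or S →
    ∀ h ∈ S, ∀ h' ∈ S, h ≠ h' → ∀ τ, ¬ (D.Sat τ h ∧ D.Sat τ h')

end NNF

/-! ### Complete structured DNNF -/

/-- A complete structured DNNF with vtree `T`. The node `label g` of `T` is the unique node whose
bag contains the gate `g`. -/
structure CompleteStructuredDNNF {V : Type} [DecidableEq V] (T : VTree V) extends NNF V where
  decomposable : toNNF.Decomposable
  label : Gate → VTree V
  label_mem : ∀ g, label g ∈ T.nodes
  /-- The bag of a leaf with variable `x` contains only inputs labelled `x` or `¬ x`. -/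
  leaf_bag : ∀ g x, label g = VTree.leaf x → ∃ b, kind g = GateKind.lit x b
  /-- The bag of a non-leaf node contains no input. -/
  node_bag : ∀ g l r, label g = VTree.node l r → ¬ (kind g).IsLit
  /-- The two inputs of an `∧`-gate belong to different nodes. -/
  and_ne : ∀ g a b, kind g = GateKind.and a b → label a ≠ label b
  /-- An input of an `∧`-gate is an `∨`-gate or an input of the circuit, at a child node. -/
  and_edge : ∀ u v, (kind v).HasInput u → (kind v).IsAnd →
    ((kind u).IsOr ∨ (kind u).IsLit) ∧ (label u).IsChild (label v)
  /-- An input of an `∨`-gate is an `∧`-gate at the same node. -/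
  or_edge : ∀ u v, (kind v).HasInput u → (kind v).IsOr → (kind u).IsAnd ∧ label u = label v
  /-- The output belongs to the root. -/
  output_root : label output = T

namespace CompleteStructuredDNNF

/-- The width: the maximal number of `∨`-gates that belong to one node of the vtree. -/
noncomputable def width {V : Type} [DecidableEq V] {T : VTree V}
    (D : CompleteStructuredDNNF T) : ℕ :=
  T.nodes.sup fun t => {g : D.Gate | D.label g = t ∧ (D.kind g).IsOr}.ncard

end CompleteStructuredDNNF

/-- The Boolean function `f` is computed by a complete structured DNNF of width `w`, with an
arbitrary vtree on an arbitrary finite set of variables. -/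
def RepresentableWithWidth {V : Type} [DecidableEq V] (f : (V → Bool) → Prop) (w : ℕ) : Prop :=
  ∃ (Y : Finset V) (T : VTree V), T.IsVTreeFor Y ∧
    ∃ D : CompleteStructuredDNNF T, D.Computes f ∧ D.width = w

/-!
The hard functions are systems of linear equations over `𝔽₂`. A single linear form is evaluated by
an automaton with two states that reads the variables in a fixed order, and automata turn into
complete structured DNNFs along a left-deep vtree whose width is the number of states
(`LayeredAutomaton.toDNNF`). Guessing a violated equation first needs two states for each of the
`n` forms. As there are no constants, no state may be unreachable; therefore one more variable,
with coefficient `1` in every form, is read first.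

For the lower bounds, let `t` be an inner node, other than the root, of the vtree of an arbitrary
complete structured DNNF. Every proof tree passes through an `∨`-gate at `t`, and below this gate it
can be exchanged freely. So the function is a union of as many rectangles, for the partition of the
variables given by `t`, as there are `∨`-gates at `t` (`CompleteStructuredDNNF.rectCover_eval`), and
`t` can be chosen such that the partition is balanced (`VTree.exists_balanced_node`).

The solutions of a homogeneous system have a fooling set of the size of `U`, the intersection of
the column spaces of the two sides of the partition (`card_inf_span_le_of_rectCover`). By counting
matrices of low rank, there is an `n × 12n` matrix for which every `4n` columns have rank more than
`3n/4`, for large `n`, so that `U` has dimension at least linear in `n` for every balanced partition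
(`exists_columns`). This is the bound for the conjunction. For the disjunction of the negations,
note that the complement of a union of `k` rectangles is a union of `2 ^ k` rectangles
(`RectCover.compl`), so `k` is at least linear in `n`.

The circuit for the disjunction shows that the cost of negation is exponential, and the values `1`
of the linear forms, in place of `0`, give the unbounded disjunction.
-/

/-! ### Evaluation of gates -/

namespace NNF

variable {V : Type} {D : NNF V} {τ : V → Bool} {g : D.Gate}

theorem sat_iff_of_kind_lit {x : V} {b : Bool} (h : D.kind g = .lit x b) :
    D.Sat τ g ↔ τ x = b := by
  refine ⟨fun hs => ?_, fun hx => .lit g x b h hx⟩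
  cases hs with
  | lit _ x' b' h' hx => rw [h] at h'; cases h'; exact hx
  | and _ _ _ h' => rw [h] at h'; cases h'
  | or _ _ _ h' => rw [h] at h'; cases h'

theorem sat_iff_of_kind_and {a b : D.Gate} (h : D.kind g = .and a b) :
    D.Sat τ g ↔ D.Sat τ a ∧ D.Sat τ b := by
  refine ⟨fun hs => ?_, fun hx => .and g a b h hx.1 hx.2⟩
  cases hs with
  | lit _ _ _ h' => rw [h] at h'; cases h'
  | and _ _ _ h' ha hb => rw [h] at h'; cases h'; exact ⟨ha, hb⟩
  | or _ _ _ h' => rw [h] at h'; cases h'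

theorem sat_iff_of_kind_or {S : Finset D.Gate} (h : D.kind g = .or S) :
    D.Sat τ g ↔ ∃ u ∈ S, D.Sat τ u := by
  refine ⟨fun hs => ?_, fun ⟨u, hu, hs⟩ => .or g S u h hu hs⟩
  cases hs with
  | lit _ _ _ h' => rw [h] at h'; cases h'
  | and _ _ _ h' => rw [h] at h'; cases h'
  | or _ S' u h' hu hs => rw [h] at h'; cases h'; exact ⟨u, hu, hs⟩

end NNF

/-! ### Linear vtrees -/

/-- The left-deep vtree on the variables `0, …, j`: the inner nodes are its prefixes. -/
def linearVTree : ℕ → VTree ℕ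
  | 0 => .leaf 0
  | j + 1 => .node (linearVTree j) (.leaf (j + 1))

theorem leaves_linearVTree (j : ℕ) : (linearVTree j).leaves = List.range (j + 1) := by
  induction j with
  | zero => rfl
  | succ j ih => rw [linearVTree, VTree.leaves, ih, VTree.leaves, ← List.range_succ]

theorem linearVTree_isVTreeFor (j : ℕ) :
    (linearVTree j).IsVTreeFor (Finset.range (j + 1)) := by
  simp [VTree.IsVTreeFor, leaves_linearVTree, List.nodup_range]

theorem linearVTree_injective : Function.Injective linearVTree := fun i j h => by
  have := congrArg (fun t => t.leaves.length) h
  simpa [leaves_linearVTree] using this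

theorem linearVTree_mem_nodes {i j : ℕ} (h : i ≤ j) :
    linearVTree i ∈ (linearVTree j).nodes := by
  induction j with
  | zero => obtain rfl : i = 0 := by omega
            simp [linearVTree, VTree.nodes]
  | succ j ih =>
    rcases Nat.le_succ_iff.1 h with h | rfl
    · simp [linearVTree, VTree.nodes, ih h]
    · simp [linearVTree, VTree.nodes]

theorem leaf_mem_nodes_linearVTree {i j : ℕ} (h : i ≤ j) :
    VTree.leaf i ∈ (linearVTree j).nodes := by
  induction j with
  | zero => obtain rfl : i = 0 := by omega
            simp [linearVTree, VTree.nodes]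
  | succ j ih =>
    rcases Nat.le_succ_iff.1 h with h | rfl
    · simp [linearVTree, VTree.nodes, ih h]
    · simp [linearVTree, VTree.nodes]

theorem linearVTree_succ_ne_leaf (j x : ℕ) : linearVTree (j + 1) ≠ .leaf x := by
  simp [linearVTree]

/-! ### Circuits from layered automata -/

/-- A nondeterministic automaton that reads the variables `0, 1, 2, …` in this order. The state
after variable `0` is `q` exactly if that variable has the value `init q`; `step j q v q'` allows
to move from `q` to `q'` if variable `j + 1` has the value `v`; and `accept q v` decides on the
last state but one and on the value of the last variable. Since circuits have no constants, every
state must be enterable at every layer, and some transition must accept. -/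
structure LayeredAutomaton (Q : Type) where
  init : Q → Bool
  step : ℕ → Q → Bool → Q → Prop
  accept : Q → Bool → Prop
  exists_step : ∀ j q', ∃ q v, step j q v q'
  exists_accept : ∃ q v, accept q v

namespace LayeredAutomaton

variable {Q : Type} (A : LayeredAutomaton Q) (M : ℕ)

/-- `A.Reach τ j q`: the automaton can be in state `q` after reading `τ 0, …, τ j`. -/
def Reach (τ : ℕ → Bool) : ℕ → Q → Prop
  | 0, q => τ 0 = A.init q
  | j + 1, q' => ∃ q, A.step j q (τ (j + 1)) q' ∧ Reach τ j q

/-- The gates of the circuit of an automaton that reads `M + 2` variables. -/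
inductive CGate (M : ℕ) (Q : Type) : Type
  | lit (j : Fin (M + 2)) (v : Bool)
  | and (j : Fin (M + 1)) (q : Q) (v : Bool)
  | or (j : Fin M) (q : Q)
  | out

namespace CGate

/-- The gate which is true if `q` is a possible state after reading the variables `0, …, j`. -/
def state (A : LayeredAutomaton Q) {M : ℕ} (q : Q) : Fin (M + 1) → CGate M Q :=
  Fin.cases (lit 0 (A.init q)) fun j => or j q

/-- The vtree node of a gate. -/
def node {M : ℕ} : CGate M Q → VTree ℕ
  | lit j _ => .leaf j
  | and j _ _ => linearVTree (j + 1)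
  | or j _ => linearVTree (j + 1)
  | out => linearVTree (M + 1)

/-- A rank that increases along the edges of the circuit. -/
def rank {M : ℕ} : CGate M Q → ℕ
  | lit _ _ => 0
  | and j _ _ => 2 * j + 1
  | or j _ => 2 * j + 2
  | out => 2 * M + 2

instance [Finite Q] {M : ℕ} : Finite (CGate M Q) := by
  let f : CGate M Q → (Fin (M + 2) × Bool) ⊕ (Fin (M + 1) × Q × Bool) ⊕ (Fin M × Q) ⊕ Unit
    | lit j v => .inl (j, v)
    | and j q v => .inr (.inl (j, q, v))
    | or j q => .inr (.inr (.inl (j, q)))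
    | out => .inr (.inr (.inr ()))
  refine Finite.of_injective f fun a b h => ?_
  cases a <;> cases b <;> simp_all [f]

/-- The `∧`-gates of the transitions that read variable `j + 1` and satisfy `R`. -/
noncomputable def fan [Finite Q] {M : ℕ} (j : Fin (M + 1)) (R : Q → Bool → Prop) :
    Finset (CGate M Q) :=
  (Set.toFinite {u | ∃ q v, R q v ∧ u = and j q v}).toFinset

theorem mem_fan [Finite Q] {M : ℕ} {j : Fin (M + 1)} {R : Q → Bool → Prop} {u : CGate M Q} :
    u ∈ fan j R ↔ ∃ q v, R q v ∧ u = and j q v :=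
  Set.Finite.mem_toFinset _

/-- The kind of a gate: `and j q v` has the inputs `state q j` and the literal of value `v` for
the variable `j + 1`; `or j q'` collects the transitions into `q'`, `out` the accepting ones. -/
noncomputable def kind [Finite Q] (A : LayeredAutomaton Q) {M : ℕ} :
    CGate M Q → GateKind ℕ (CGate M Q)
  | lit j v => .lit j v
  | and j q v => .and (state A q j) (lit j.succ v)
  | or j q' => .or (fan j.castSucc fun q v => A.step j q v q')
  | out => .or (fan (Fin.last M) A.accept)

end CGate

open CGate

theorem state_cases (q : Q) (j : Fin (M + 1)) :
    (j = 0 ∧ state A q j = CGate.lit 0 (A.init q)) ∨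
      ∃ i : Fin M, j = i.succ ∧ state A q j = CGate.or i q := by
  induction j using Fin.cases with
  | zero => exact .inl ⟨rfl, rfl⟩
  | succ i => exact .inr ⟨i, rfl, rfl⟩

theorem node_state (q : Q) (j : Fin (M + 1)) : (state A q j).node = linearVTree j := by
  induction j using Fin.cases with
  | zero => rfl
  | succ i => rfl

variable [Finite Q]

theorem hasInput_cases {u v : CGate M Q} (h : (v.kind A).HasInput u) :
    (∃ j q b, v = .and j q b ∧ (u = state A q j ∨ u = .lit j.succ b)) ∨
    (∃ j q q' b, v = .or j q' ∧ u = .and j.castSucc q b ∧ A.step j q b q') ∨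
    (∃ q b, v = .out ∧ u = .and (Fin.last M) q b ∧ A.accept q b) := by
  cases v with
  | lit j b => exact h.elim
  | and j q b => exact .inl ⟨j, q, b, rfl, h⟩
  | or j q' =>
    obtain ⟨q, b, h1, h2⟩ := mem_fan.1 h
    exact .inr (.inl ⟨j, q, q', b, rfl, h2, h1⟩)
  | out =>
    obtain ⟨q, b, h1, h2⟩ := mem_fan.1 h
    exact .inr (.inr ⟨q, b, rfl, h2, h1⟩)

theorem rank_lt {u v : CGate M Q} (h : (v.kind A).HasInput u) : u.rank < v.rank := by
  rcases hasInput_cases A M h with ⟨j, q, b, rfl, rfl | rfl⟩ | ⟨j, q, q', b, rfl, rfl, -⟩ |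
    ⟨q, b, rfl, rfl, -⟩
  · induction j using Fin.cases with
    | zero => simp [state, rank]
    | succ i => simp [state, rank]; omega
  all_goals simp [rank]

/-- The circuit of an automaton, as a circuit in negation normal form. -/
noncomputable def toNNF : NNF ℕ where
  Gate := CGate M Q
  finite_gate := inferInstance
  kind := CGate.kind A
  or_nonempty := by
    rintro g S hg
    cases g with
    | lit j b => cases hg
    | and j q b => cases hg
    | or j q' =>
      cases hg
      obtain ⟨q, v, h⟩ := A.exists_step j q'
      exact ⟨_, mem_fan.2 ⟨q, v, h, rfl⟩⟩
    | out =>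
      cases hg
      obtain ⟨q, v, h⟩ := A.exists_accept
      exact ⟨_, mem_fan.2 ⟨q, v, h, rfl⟩⟩
  acyclic := Subrelation.wf (fun h => rank_lt A M h) (measure CGate.rank).wf
  output := .out

theorem leaves_subset_of_hasInput {u v : CGate M Q} (h : (v.kind A).HasInput u) :
    u.node.leaves ⊆ v.node.leaves := by
  intro x hx
  rcases hasInput_cases A M h with ⟨j, q, b, rfl, rfl | rfl⟩ | ⟨j, q, q', b, rfl, rfl, -⟩ |
    ⟨q, b, rfl, rfl, -⟩
  · rw [node_state, leaves_linearVTree, List.mem_range] at hx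
    rw [CGate.node, leaves_linearVTree, List.mem_range]
    omega
  · simp only [CGate.node, VTree.leaves, List.mem_singleton, Fin.val_succ] at hx
    rw [CGate.node, leaves_linearVTree, List.mem_range]
    omega
  · exact hx
  · exact hx

theorem varsBelow_subset (g : CGate M Q) {x : ℕ} (hx : x ∈ (A.toNNF M).varsBelow g) :
    x ∈ g.node.leaves := by
  obtain ⟨h, b, hr, hk⟩ := hx
  induction hr with
  | refl =>
    cases h <;> cases hk
    simp [CGate.node, VTree.leaves]
  | tail _ he ih => exact leaves_subset_of_hasInput A M he ih

/-- The circuit of an automaton, as a complete structured DNNF. -/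
noncomputable def toDNNF : CompleteStructuredDNNF (linearVTree (M + 1)) where
  toNNF := A.toNNF M
  decomposable := by
    intro g a b hg
    change CGate.kind A g = _ at hg
    cases g <;> cases hg
    rw [Set.disjoint_left]
    intro x ha hb
    replace ha := varsBelow_subset A M _ ha
    replace hb := varsBelow_subset A M _ hb
    rw [node_state, leaves_linearVTree, List.mem_range] at ha
    simp only [CGate.node, VTree.leaves, List.mem_singleton, Fin.val_succ] at hb
    omega
  label := CGate.node
  label_mem g := by
    change CGate M Q at g
    cases g with
    | lit j b => exact leaf_mem_nodes_linearVTree (by omega)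
    | and j q b => exact linearVTree_mem_nodes (by omega)
    | or j q => exact linearVTree_mem_nodes (by omega)
    | out => exact linearVTree_mem_nodes le_rfl
  leaf_bag g x hg := by
    change CGate M Q at g
    cases g with
    | lit j b => cases hg; exact ⟨b, rfl⟩
    | and j q b => exact (linearVTree_succ_ne_leaf _ _ hg).elim
    | or j q => exact (linearVTree_succ_ne_leaf _ _ hg).elim
    | out => exact (linearVTree_succ_ne_leaf _ _ hg).elim
  node_bag g l r hg hl := by
    change CGate M Q at g
    cases g with
    | lit j b => cases hg
    | and j q b => exact hl
    | or j q => exact hl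
    | out => exact hl
  and_ne g a b hg := by
    change CGate.kind A g = _ at hg
    cases g <;> cases hg
    intro h
    have := congrArg VTree.leaves h
    rw [node_state, leaves_linearVTree] at this
    simpa [CGate.node, VTree.leaves] using congrArg (0 ∈ ·) this
  and_edge u v h hv := by
    rcases hasInput_cases A M h with ⟨j, q, b, rfl, rfl | rfl⟩ | ⟨j, q, q', b, rfl, rfl, -⟩ |
      ⟨q, b, rfl, rfl, -⟩
    · refine ⟨?_, .inl (node_state A M q j)⟩
      rcases state_cases A M q j with ⟨-, h⟩ | ⟨i, -, h⟩
      · rw [h]; exact .inr trivial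
      · rw [h]; exact .inl trivial
    · exact ⟨.inr trivial, .inr (by simp [CGate.node])⟩
    · exact hv.elim
    · exact hv.elim
  or_edge u v h hv := by
    rcases hasInput_cases A M h with ⟨j, q, b, rfl, -⟩ | ⟨j, q, q', b, rfl, rfl, -⟩ |
      ⟨q, b, rfl, rfl, -⟩
    · exact hv.elim
    · exact ⟨trivial, rfl⟩
    · exact ⟨trivial, rfl⟩
  output_root := rfl

variable {M}

theorem sat_and_iff (τ : ℕ → Bool) (j : Fin (M + 1)) (q : Q) (v : Bool) :
    (A.toNNF M).Sat τ (.and j q v : CGate M Q) ↔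
      (A.toNNF M).Sat τ (state A q j : CGate M Q) ∧ τ (j + 1) = v := by
  rw [NNF.sat_iff_of_kind_and (D := A.toNNF M) (g := (.and j q v : CGate M Q)) rfl,
    NNF.sat_iff_of_kind_lit (D := A.toNNF M) (g := (.lit j.succ v : CGate M Q)) rfl, Fin.val_succ]

theorem sat_state_iff (τ : ℕ → Bool) (j : Fin (M + 1)) (q : Q) :
    (A.toNNF M).Sat τ (state A q j : CGate M Q) ↔ A.Reach τ j q := by
  induction j using Fin.induction generalizing q with
  | zero => exact NNF.sat_iff_of_kind_lit (D := A.toNNF M) (g := (.lit 0 _ : CGate M Q)) rfl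
  | succ i ih =>
    refine (NNF.sat_iff_of_kind_or (D := A.toNNF M) (g := (.or i q : CGate M Q)) rfl).trans ?_
    constructor
    · rintro ⟨u, hu', hu⟩
      obtain ⟨q', v, hs, rfl⟩ := mem_fan.1 hu'
      rw [sat_and_iff, ih] at hu
      obtain ⟨hu, rfl⟩ := hu
      exact ⟨q', hs, hu⟩
    · rintro ⟨q', hs, hr⟩
      exact ⟨_, mem_fan.2 ⟨q', _, hs, rfl⟩, (sat_and_iff A _ _ _ _).2 ⟨(ih _).2 hr, rfl⟩⟩

theorem eval_toDNNF (τ : ℕ → Bool) :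
    (A.toDNNF M).Eval τ ↔ ∃ q, A.accept q (τ (M + 1)) ∧ A.Reach τ M q := by
  refine (NNF.sat_iff_of_kind_or (D := A.toNNF M) (g := (.out : CGate M Q)) rfl).trans ?_
  constructor
  · rintro ⟨u, hu', hu⟩
    obtain ⟨q', v, hs, rfl⟩ := mem_fan.1 hu'
    rw [sat_and_iff, sat_state_iff] at hu
    obtain ⟨hu, rfl⟩ := hu
    exact ⟨q', hs, hu⟩
  · rintro ⟨q', hs, hr⟩
    exact ⟨_, mem_fan.2 ⟨q', _, hs, rfl⟩, (sat_and_iff A _ _ _ _).2 ⟨(sat_state_iff A _ _ _).2 hr, rfl⟩⟩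

/-- The circuit of an automaton that has at most one run on every input is deterministic. -/
theorem deterministic_toDNNF
    (h : ∀ τ j q q', A.Reach τ j q → A.Reach τ j q' → q = q') :
    (A.toDNNF M).Deterministic := by
  have key : ∀ (j : Fin (M + 1)) (q q' : Q) (v v' : Bool) (τ : ℕ → Bool),
      (A.toNNF M).Sat τ (.and j q v : CGate M Q) →
      (A.toNNF M).Sat τ (.and j q' v' : CGate M Q) → q = q' ∧ v = v' := by
    intro j q q' v v' τ h1 h2
    rw [sat_and_iff, sat_state_iff] at h1 h2
    exact ⟨h τ j _ _ h1.1 h2.1, h1.2.symm.trans h2.2⟩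
  rintro g S hg u hu u' hu' hne τ ⟨h1, h2⟩
  change CGate.kind A g = _ at hg
  cases g <;> cases hg
  all_goals
    obtain ⟨q, v, -, rfl⟩ := mem_fan.1 hu
    obtain ⟨q', v', -, rfl⟩ := mem_fan.1 hu'
    obtain ⟨rfl, rfl⟩ := key _ q q' v v' τ h1 h2
    exact hne rfl

/-- The inner nodes below the root carry one `∨`-gate for each state. -/
theorem width_toDNNF [Nonempty Q] (hM : 1 ≤ M) : (A.toDNNF M).width = Nat.card Q := by
  have hor : ∀ j : Fin M, {g : CGate M Q | g.node = linearVTree (j + 1) ∧ (g.kind A).IsOr} =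
      Set.range (CGate.or j) := by
    intro j
    ext g
    cases g with
    | lit i b => simp [CGate.kind, GateKind.IsOr]
    | and i q b => simp [CGate.kind, GateKind.IsOr]
    | or i q =>
      simp only [Set.mem_ofPred_eq, CGate.node, CGate.kind, GateKind.IsOr, and_true,
        linearVTree_injective.eq_iff, Set.mem_range, CGate.or.injEq, exists_eq_right]
      omega
    | out =>
      simp only [Set.mem_ofPred_eq, CGate.node, CGate.kind, GateKind.IsOr, and_true,
        linearVTree_injective.eq_iff, Set.mem_range, reduceCtorEq, exists_false, iff_false]
      omega
  have hcard : ∀ j : Fin M, (Set.range (CGate.or j : Q → CGate M Q)).ncard = Nat.card Q := by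
    intro j
    rw [← Set.image_univ, Set.ncard_image_of_injective _ (fun a b h => by cases h; rfl),
      Set.ncard_univ]
  apply le_antisymm
  · refine Finset.sup_le fun t _ => ?_
    change {g : CGate M Q | g.node = t ∧ (g.kind A).IsOr}.ncard ≤ _
    by_cases hj : ∃ j : Fin M, t = linearVTree (j + 1)
    · obtain ⟨j, rfl⟩ := hj
      rw [hor, hcard]
    · calc _ ≤ ({.out} : Set (CGate M Q)).ncard := by
            refine Set.ncard_le_ncard (fun g hg => ?_)
            obtain ⟨h1, h2⟩ := hg
            cases g with
            | lit i b => exact h2.elim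
            | and i q b => exact h2.elim
            | or i q => exact (hj ⟨i, h1.symm⟩).elim
            | out => rfl
        _ ≤ _ := by rw [Set.ncard_singleton]; exact Nat.card_pos
  · rw [← hcard ⟨0, hM⟩, ← hor]
    exact Finset.le_sup (f := fun t => {g : CGate M Q | g.node = t ∧ (g.kind A).IsOr}.ncard)
      (linearVTree_mem_nodes (by simp))

end LayeredAutomaton

/-! ### Rectangle covers from circuits -/

/-- `f` is the union of at most `k` rectangles for the partition of the variables into `S` and its
complement: each of them is the conjunction of a function that depends on `S` only and of a
function that does not depend on `S`. -/
def RectCover {V : Type} (f : (V → Bool) → Prop) (S : Set V) (k : ℕ) : Prop :=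
  ∃ (ι : Type) (_ : Finite ι) (P Q : ι → (V → Bool) → Prop), Nat.card ι ≤ k ∧
    (∀ i τ τ', (∀ x ∈ S, τ x = τ' x) → P i τ → P i τ') ∧
    (∀ i τ τ', (∀ x ∉ S, τ x = τ' x) → Q i τ → Q i τ') ∧
    ∀ τ, f τ ↔ ∃ i, P i τ ∧ Q i τ

/-- A point satisfies the complement of a union of `k` rectangles exactly if it fails the first
side of some of them and the second side of all the others. -/
theorem RectCover.compl {V : Type} {f : (V → Bool) → Prop} {S : Set V} {k : ℕ}
    (h : RectCover f S k) : RectCover (fun τ => ¬ f τ) S (2 ^ k) := by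
  obtain ⟨ι, hι, P, Q, hk, hP, hQ, hf⟩ := h
  refine ⟨Set ι, inferInstance, fun J τ => ∀ i ∈ J, ¬ P i τ, fun J τ => ∀ i ∉ J, ¬ Q i τ,
    ?_, ?_, ?_, ?_⟩
  · have := Fintype.ofFinite ι
    rw [Nat.card_eq_fintype_card] at hk ⊢
    rw [Fintype.card_set]
    exact Nat.pow_le_pow_right (by norm_num) hk
  · exact fun J τ τ' h hJ i hi hp => hJ i hi (hP i τ' τ (fun x hx => (h x hx).symm) hp)
  · exact fun J τ τ' h hJ i hi hp => hJ i hi (hQ i τ' τ (fun x hx => (h x hx).symm) hp)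
  · intro τ
    beta_reduce
    rw [hf]
    constructor
    · intro h
      refine ⟨{i | ¬ P i τ}, fun i hi => hi, fun i hi hq => h ⟨i, by simpa using hi, hq⟩⟩
    · rintro ⟨J, h1, h2⟩ ⟨i, hp, hq⟩
      by_cases hi : i ∈ J
      exacts [h1 i hi hp, h2 i hi hq]

/-- A function that depends on `S` only is a single rectangle. -/
theorem RectCover.of_dependsOn {V : Type} {f : (V → Bool) → Prop} {S : Set V}
    (h : ∀ τ τ', (∀ x ∈ S, τ x = τ' x) → f τ → f τ') : RectCover f S 1 :=
  ⟨Unit, inferInstance, fun _ => f, fun _ _ => True, by simp, fun _ => h, by simp, by simp⟩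

theorem RectCover.mono {V : Type} {f : (V → Bool) → Prop} {S : Set V} {k l : ℕ}
    (h : RectCover f S k) (hkl : k ≤ l) : RectCover f S l := by
  obtain ⟨ι, hι, P, Q, hk, h⟩ := h
  exact ⟨ι, hι, P, Q, hk.trans hkl, h⟩

/-- A single rectangle contains the mixtures of its points. -/
theorem RectCover.mix {V : Type} {f : (V → Bool) → Prop} {S : Set V} (h : RectCover f S 1)
    {τ τ' ρ : V → Bool} (hτ : f τ) (hτ' : f τ') (h1 : ∀ x ∈ S, τ x = ρ x)
    (h2 : ∀ x ∉ S, τ' x = ρ x) : f ρ := by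
  obtain ⟨ι, hι, P, Q, hk, hP, hQ, hf⟩ := h
  have := Finite.card_le_one_iff_subsingleton.1 hk
  obtain ⟨i, hi, -⟩ := (hf τ).1 hτ
  obtain ⟨j, -, hj⟩ := (hf τ').1 hτ'
  obtain rfl := Subsingleton.elim i j
  exact (hf ρ).2 ⟨i, hP _ _ _ h1 hi, hQ _ _ _ h2 hj⟩

namespace VTree

variable {V : Type} [DecidableEq V]

theorem self_mem_nodes (T : VTree V) : T ∈ T.nodes := by
  cases T <;> simp [nodes]

theorem leaves_subset_of_mem_nodes {t T : VTree V} (h : t ∈ T.nodes) : t.leaves ⊆ T.leaves := by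
  induction T with
  | leaf x => simp_all [nodes]
  | node l r hl hr =>
    simp only [nodes, Finset.mem_insert, Finset.mem_union] at h
    rcases h with rfl | h | h
    · exact fun _ h => h
    · exact fun x hx => List.mem_append_left _ (hl h hx)
    · exact fun x hx => List.mem_append_right _ (hr h hx)

theorem nodup_of_mem_nodes {t T : VTree V} (h : t ∈ T.nodes) (hT : T.leaves.Nodup) :
    t.leaves.Nodup := by
  induction T with
  | leaf x => simp_all [nodes]
  | node l r hl hr =>
    simp only [nodes, Finset.mem_insert, Finset.mem_union] at h
    rcases h with rfl | h | h
    · exact hT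
    · exact hl h (List.nodup_append.1 hT).1
    · exact hr h (List.nodup_append.1 hT).2.1

/-- If a vtree contains at least `s` of the at least `3 * s` variables in `X`, then so does one of
its nodes that leaves out `s` others: descend into a child with at least `s` of them as long as
fewer than `s` are left out. -/
theorem exists_balanced_node {X : Finset V} {s : ℕ} (hs : 2 ≤ s) (hX : 3 * s ≤ X.card)
    (T : VTree V) (h : s ≤ (X.filter (· ∈ T.leaves)).card) :
    ∃ t ∈ T.nodes, (∀ x, t ≠ leaf x) ∧
      s ≤ (X.filter (· ∈ t.leaves)).card ∧ s ≤ (X.filter (· ∉ t.leaves)).card := by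
  have hsplit (t : VTree V) :=
    Finset.card_filter_add_card_filter_not (s := X) (· ∈ t.leaves)
  induction T with
  | leaf x =>
    have : (X.filter (· ∈ (leaf x).leaves)).card ≤ ({x} : Finset V).card :=
      Finset.card_le_card fun y hy => by simpa [leaves] using (Finset.mem_filter.1 hy).2
    rw [Finset.card_singleton] at this
    omega
  | node l r hl hr =>
    by_cases hc : s ≤ (X.filter (· ∉ (node l r).leaves)).card
    · exact ⟨_, self_mem_nodes _, by simp, h, hc⟩
    · have hle : (X.filter (· ∈ (node l r).leaves)).card ≤
          (X.filter (· ∈ l.leaves)).card + (X.filter (· ∈ r.leaves)).card := by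
        refine le_trans (Finset.card_le_card ?_) (Finset.card_union_le _ _)
        intro x
        simp only [leaves, List.mem_append, Finset.mem_filter, Finset.mem_union]
        tauto
      have := hsplit (node l r)
      rcases le_or_gt s (X.filter (· ∈ l.leaves)).card with h' | h'
      · obtain ⟨t, ht, h1⟩ := hl h'
        exact ⟨t, by simp [nodes, ht], h1⟩
      · obtain ⟨t, ht, h1⟩ := hr (by omega)
        exact ⟨t, by simp [nodes, ht], h1⟩

end VTree

namespace CompleteStructuredDNNF

variable {V : Type} [DecidableEq V] {T : VTree V} (D : CompleteStructuredDNNF T)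

theorem leaf_of_kind_lit {g : D.Gate} {x : V} {b : Bool} (h : D.kind g = .lit x b) :
    D.label g = .leaf x := by
  cases ht : D.label g with
  | leaf y =>
    obtain ⟨b', h'⟩ := D.leaf_bag g y ht
    rw [h] at h'
    cases h'
    rfl
  | node l r => exact (D.node_bag g l r ht (by rw [h]; trivial)).elim

/-- The label of an `∧`-gate is an inner node, whose children are the labels of its inputs. -/
theorem children_of_kind_and {g a b : D.Gate} (h : D.kind g = .and a b) :
    ∃ l r, D.label g = .node l r ∧
      ((D.label a = l ∧ D.label b = r) ∨ (D.label a = r ∧ D.label b = l)) := by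
  have ha := (D.and_edge a g (by rw [h]; exact .inl rfl) (by rw [h]; trivial)).2
  have hb := (D.and_edge b g (by rw [h]; exact .inr rfl) (by rw [h]; trivial)).2
  have hne := D.and_ne g a b h
  cases ht : D.label g with
  | leaf y => rw [ht] at ha; exact ha.elim
  | node l r =>
    rw [ht] at ha hb
    refine ⟨l, r, rfl, ?_⟩
    rcases ha with ha | ha <;> rcases hb with hb | hb
    · exact (hne (ha.trans hb.symm)).elim
    · exact .inl ⟨ha, hb⟩
    · exact .inr ⟨ha, hb⟩
    · exact (hne (ha.trans hb.symm)).elim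

/-- The value of a gate depends only on the variables below its node of the vtree. -/
theorem sat_congr {τ τ' : V → Bool} {g : D.Gate} (h : ∀ x ∈ (D.label g).leaves, τ x = τ' x)
    (hs : D.Sat τ g) : D.Sat τ' g := by
  induction hs with
  | lit g x b hk hx =>
    exact .lit g x b hk (by rw [← h x (by simp [D.leaf_of_kind_lit hk, VTree.leaves]), hx])
  | and g a b hk _ _ iha ihb =>
    obtain ⟨l, r, hg, hab⟩ := D.children_of_kind_and hk
    rw [hg] at h
    simp only [VTree.leaves, List.mem_append] at h
    rcases hab with ⟨ha, hb⟩ | ⟨ha, hb⟩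
    · exact .and g a b hk (iha fun x hx => h x (.inl (ha ▸ hx)))
        (ihb fun x hx => h x (.inr (hb ▸ hx)))
    · exact .and g a b hk (iha fun x hx => h x (.inr (ha ▸ hx)))
        (ihb fun x hx => h x (.inl (hb ▸ hx)))
  | or g S u hk hu _ ih =>
    have := (D.or_edge u g (by rw [hk]; exact hu) (by rw [hk]; trivial)).2
    exact .or g S u hk hu (ih fun x hx => h x (this ▸ hx))

/-- If a gate `h` is true, then this is witnessed by some `∨`-gate `g` at the inner node `t` of
the vtree: in a proof tree of `h`, the part below `g` can be replaced by any other proof tree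
of `g`. An `∧`-gate at `t` itself has to be excluded since no `∨`-gate need lie below it. -/
theorem exists_or_gate_of_sat {t : VTree V} (hT : T.leaves.Nodup) (ht : ∀ x, t ≠ .leaf x)
    {τ : V → Bool} {h : D.Gate} (hs : D.Sat τ h) (hth : t ∈ (D.label h).nodes)
    (hne : D.label h = t → (D.kind h).IsOr) :
    ∃ g, (D.label g = t ∧ (D.kind g).IsOr) ∧ D.Sat τ g ∧
      ∀ τ', (∀ x ∉ t.leaves, τ x = τ' x) → D.Sat τ' g → D.Sat τ' h := by
  induction hs with
  | lit h x b hk hx =>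
    rw [D.leaf_of_kind_lit hk] at hth
    simp only [VTree.nodes, Finset.mem_singleton] at hth
    exact (ht x hth).elim
  | and h a b hk hsa hsb iha ihb =>
    obtain ⟨l, r, hg, hab⟩ := D.children_of_kind_and hk
    have hnd : (VTree.node l r).leaves.Nodup := hg ▸ VTree.nodup_of_mem_nodes (D.label_mem h) hT
    have hdisj := (List.nodup_append.1 hnd).2.2
    have hor : ∀ u, u = a ∨ u = b → D.label u = t → (D.kind u).IsOr := by
      intro u hu hut
      refine (D.and_edge u h (by rw [hk]; exact hu) (by rw [hk]; trivial)).1.resolve_right ?_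
      intro hl
      cases hku : D.kind u with
      | lit x c => exact ht x (hut ▸ D.leaf_of_kind_lit hku)
      | and => rw [hku] at hl; exact hl
      | or => rw [hku] at hl; exact hl
    have hht : D.label h ≠ t := fun e => by
      have := hne e
      rw [hk] at this
      exact this
    have hlr : t ∈ l.nodes ∨ t ∈ r.nodes := by
      rw [hg, VTree.nodes, Finset.mem_insert, Finset.mem_union] at hth
      exact hth.resolve_left fun e => hht (hg.trans e.symm)
    -- The input whose node lies above `t` is handled by induction, the other one does not see `t`.
    have hta : (t ∈ (D.label a).nodes ∧ ∀ x ∈ (D.label b).leaves, x ∉ t.leaves) ∨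
        (t ∈ (D.label b).nodes ∧ ∀ x ∈ (D.label a).leaves, x ∉ t.leaves) := by
      have hl : t ∈ l.nodes → ∀ x ∈ r.leaves, x ∉ t.leaves := fun h x hx hxt =>
        hdisj x (VTree.leaves_subset_of_mem_nodes h hxt) x hx rfl
      have hr : t ∈ r.nodes → ∀ x ∈ l.leaves, x ∉ t.leaves := fun h x hx hxt =>
        hdisj x hx x (VTree.leaves_subset_of_mem_nodes h hxt) rfl
      rcases hab with ⟨rfl, rfl⟩ | ⟨rfl, rfl⟩ <;> tauto
    rcases hta with ⟨h1, h2⟩ | ⟨h1, h2⟩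
    · obtain ⟨g, hg1, hg2, hg3⟩ := iha h1 (hor a (.inl rfl))
      exact ⟨g, hg1, hg2, fun τ' hτ hs => .and h a b hk (hg3 τ' hτ hs)
        (D.sat_congr (fun x hx => hτ x (h2 x hx)) hsb)⟩
    · obtain ⟨g, hg1, hg2, hg3⟩ := ihb h1 (hor b (.inr rfl))
      exact ⟨g, hg1, hg2, fun τ' hτ hs => .and h a b hk
        (D.sat_congr (fun x hx => hτ x (h2 x hx)) hsa) (hg3 τ' hτ hs)⟩
  | or h S u hk hu hsu ih =>
    by_cases hht : D.label h = t
    · exact ⟨h, ⟨hht, hne hht⟩, .or h S u hk hu hsu, fun _ _ hs => hs⟩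
    · have hl := (D.or_edge u h (by rw [hk]; exact hu) (by rw [hk]; trivial)).2
      obtain ⟨g, hg1, hg2, hg3⟩ := ih (hl ▸ hth) fun e => (hht (hl ▸ e)).elim
      exact ⟨g, hg1, hg2, fun τ' hτ hs => .or h S u hk hu (hg3 τ' hτ hs)⟩

/-- The function of a circuit is a union of as many rectangles as there are `∨`-gates at an inner
node other than the root. -/
theorem rectCover_eval {t : VTree V} (hT : T.leaves.Nodup) (ht : ∀ x, t ≠ .leaf x)
    (htT : t ∈ T.nodes) (hne : t ≠ T) : RectCover D.Eval {x | x ∈ t.leaves} D.width := by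
  have := D.finite_gate
  refine ⟨{g : D.Gate | D.label g = t ∧ (D.kind g).IsOr}, inferInstance,
    fun g τ => D.Sat τ g.1,
    fun g τ => ∀ τ', (∀ x ∉ t.leaves, τ x = τ' x) → D.Sat τ' g.1 → D.Eval τ', ?_, ?_, ?_, ?_⟩
  · rw [Nat.card_coe_set_eq]
    exact Finset.le_sup (f := fun t => {g : D.Gate | D.label g = t ∧ (D.kind g).IsOr}.ncard) htT
  · intro g τ τ' h hs
    exact D.sat_congr (by rwa [g.2.1]) hs
  · exact fun g τ τ' h hs τ'' h' => hs τ'' fun x hx => (h x hx).trans (h' x hx)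
  · intro τ
    constructor
    · intro hs
      obtain ⟨g, h1, h2, h3⟩ := D.exists_or_gate_of_sat hT ht hs (by rwa [D.output_root])
        fun e => (hne (e.symm.trans D.output_root)).elim
      exact ⟨⟨g, h1⟩, h2, h3⟩
    · rintro ⟨g, h1, h2⟩
      exact h2 τ (fun _ _ => rfl) h1

end CompleteStructuredDNNF

/-- Lower bounds on rectangle covers for all balanced partitions of `X` are lower bounds on the
width, for arbitrary vtrees. -/
theorem le_width_of_forall_rectCover {V : Type} [DecidableEq V] {f : (V → Bool) → Prop}
    {X : Finset V} {s m : ℕ} (hs : 2 ≤ s) (hX : 3 * s ≤ X.card) (hm : 2 ≤ m)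
    (hf : ∀ S : Set V, ∀ A B : Finset V, A ⊆ X → B ⊆ X → (∀ x ∈ A, x ∈ S) → (∀ x ∈ B, x ∉ S) →
      s ≤ A.card → s ≤ B.card → ∀ k, RectCover f S k → m ≤ k)
    {w : ℕ} (hw : RepresentableWithWidth f w) : m ≤ w := by
  obtain ⟨Y, T, hT, D, hD, rfl⟩ := hw
  obtain rfl : D.Eval = f := funext fun τ => propext (hD τ)
  have hdep : ∀ τ τ', (∀ x ∈ T.leaves, τ x = τ' x) → D.Eval τ → D.Eval τ' := fun τ τ' h hs =>
    D.sat_congr (by rwa [D.output_root]) hs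
  by_cases hsT : s ≤ (X.filter (· ∈ T.leaves)).card
  · obtain ⟨t, ht, hl, h1, h2⟩ := VTree.exists_balanced_node hs hX T hsT
    refine hf {x | x ∈ t.leaves} _ _ (Finset.filter_subset _ _) (Finset.filter_subset _ _)
      (fun x hx => (Finset.mem_filter.1 hx).2) (fun x hx => (Finset.mem_filter.1 hx).2) h1 h2 _ ?_
    by_cases hne : t = T
    -- At the root, the function is a single rectangle, which `m ≥ 2` excludes.
    · subst hne
      have := hf {x | x ∈ t.leaves} _ _ (Finset.filter_subset _ _) (Finset.filter_subset _ _)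
        (fun x hx => (Finset.mem_filter.1 hx).2) (fun x hx => (Finset.mem_filter.1 hx).2) h1 h2 1
        (.of_dependsOn hdep)
      omega
    · exact D.rectCover_eval hT.1 hl ht hne
  -- A vtree with few variables of `X` would make the function independent of most of them.
  · obtain ⟨A, hA1, hA2, hA3⟩ := Finset.exists_subsuperset_card_eq
      (Finset.filter_subset (· ∈ T.leaves) X) (le_of_not_ge hsT) (by omega : s ≤ X.card)
    have hB : s ≤ (X \ A).card := by
      rw [Finset.card_sdiff_of_subset hA2]
      omega
    have := hf {x | x ∈ T.leaves ∨ x ∈ A} A (X \ A) hA2 Finset.sdiff_subset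
      (fun x hx => .inr hx) (fun x hx hxS => ?_) hA3.ge hB 1
      (.of_dependsOn fun τ τ' h => hdep τ τ' fun x hx => h x (.inl hx))
    · omega
    · rw [Finset.mem_sdiff] at hx
      exact hx.2 (hxS.elim (fun h => hA1 (Finset.mem_filter.2 ⟨hx.1, h⟩)) id)

/-! ### Systems of linear equations across a partition of the variables -/

/-- The sum of the vectors `c k`, over the true variables `k < N`. -/
def subsetSum {W : Type*} [AddCommMonoid W] (c : ℕ → W) (N : ℕ) (τ : ℕ → Bool) : W :=
  ∑ k ∈ Finset.range N, if τ k then c k else 0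

theorem subsetSum_succ {W : Type*} [AddCommMonoid W] (c : ℕ → W) (N : ℕ) (τ : ℕ → Bool) :
    subsetSum c (N + 1) τ = subsetSum c N τ + if τ N then c N else 0 :=
  Finset.sum_range_succ _ _

theorem subsetSum_eq_of_disjoint {W : Type*} [AddCommMonoid W] {c : ℕ → W} {N : ℕ} {P Q : Finset ℕ} (hPQ : Disjoint P Q)
    (hP : P ⊆ Finset.range N) (hQ : Q ⊆ Finset.range N) :
    subsetSum c N (fun k => decide (k ∈ P ∪ Q)) = ∑ k ∈ P, c k + ∑ k ∈ Q, c k := by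
  rw [← Finset.sum_union hPQ, subsetSum, ← Finset.sum_filter]
  congr 1
  ext k
  have := Finset.union_subset hP hQ
  simp only [Finset.mem_filter, decide_eq_true_eq]
  exact ⟨fun h => h.2, fun h => ⟨this h, h⟩⟩

section

variable {W : Type*} [AddCommGroup W] [Module (ZMod 2) W]

theorem exists_subset_sum_eq_of_mem_span {c : ℕ → W} {A : Finset ℕ} {z : W}
    (hz : z ∈ Submodule.span (ZMod 2) (c '' A)) : ∃ P ⊆ A, ∑ k ∈ P, c k = z := by
  obtain ⟨a, rfl⟩ := Submodule.mem_span_image_finset_iff_exists_fun' (ZMod 2) |>.1 hz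
  refine ⟨A.filter fun k => a k ≠ 0, Finset.filter_subset _ _, ?_⟩
  rw [Finset.sum_filter]
  refine Finset.sum_congr rfl fun k _ => ?_
  have h2 : ∀ x : ZMod 2, x = 0 ∨ x = 1 := by decide
  rcases h2 (a k) with h | h <;> simp [h]

/-- Every pair of vectors that are both a sum of columns from `S` and a sum of columns from outside
is realized by a point whose part in `S` sums to the first vector, and whose other part to the
second one; the parts can be chosen independently of each other. -/
theorem exists_points (c : ℕ → W) {N : ℕ} {S : Set ℕ} {A B : Finset ℕ}
    (hAN : A ⊆ Finset.range N) (hBN : B ⊆ Finset.range N)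
    (hA : ∀ x ∈ A, x ∈ S) (hB : ∀ x ∈ B, x ∉ S) :
    ∃ point : ↥(Submodule.span (ZMod 2) (c '' A) ⊓ Submodule.span (ZMod 2) (c '' B)) →
        ↥(Submodule.span (ZMod 2) (c '' A) ⊓ Submodule.span (ZMod 2) (c '' B)) → ℕ → Bool,
      (∀ y z, subsetSum c N (point y z) = y + z) ∧
      (∀ y z z', ∀ x ∈ S, point y z x = point y z' x) ∧
      ∀ y y' z, ∀ x ∉ S, point y z x = point y' z x := by
  set U := Submodule.span (ZMod 2) (c '' A) ⊓ Submodule.span (ZMod 2) (c '' B)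
  have h1 (z : U) : ∃ p ⊆ A, ∑ k ∈ p, c k = z := exists_subset_sum_eq_of_mem_span z.2.1
  have h2 (z : U) : ∃ q ⊆ B, ∑ k ∈ q, c k = z := exists_subset_sum_eq_of_mem_span z.2.2
  choose p hpA hp using h1
  choose q hqB hq using h2
  refine ⟨fun y z k => decide (k ∈ p y ∪ q z), fun y z => ?_, fun y z z' x hx => ?_,
    fun y y' z x hx => ?_⟩
  · have hd : Disjoint (p y) (q z) := Finset.disjoint_left.2 fun x hx hx' =>
      hB x (hqB z hx') (hA x (hpA y hx))
    rw [subsetSum_eq_of_disjoint hd ((hpA y).trans hAN) ((hqB z).trans hBN), hp, hq]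
  · have : ∀ z, x ∉ q z := fun z hz => hB x (hqB z hz) hx
    simp [this]
  · have : ∀ z, x ∉ p z := fun z hz => hx (hA x (hpA z hz))
    simp [this]

/-- The solutions of a homogeneous linear system over `𝔽₂` with columns `c k` have a fooling set
indexed by the vectors which are both a sum of columns from `S` and a sum of columns from outside:
representing such a vector on both sides gives a solution, and exchanging the parts of two of these
solutions gives a point that violates the system. -/
theorem card_inf_span_le_of_rectCover {c : ℕ → W} {N : ℕ} {S : Set ℕ} {A B : Finset ℕ}
    (hAN : A ⊆ Finset.range N) (hBN : B ⊆ Finset.range N)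
    (hA : ∀ x ∈ A, x ∈ S) (hB : ∀ x ∈ B, x ∉ S) {k : ℕ}
    (h : RectCover (fun τ => subsetSum c N τ = 0) S k) :
    Nat.card ↥(Submodule.span (ZMod 2) (c '' A) ⊓ Submodule.span (ZMod 2) (c '' B)) ≤ k := by
  obtain ⟨ι, hι, P, Q, hk, hP, hQ, hf⟩ := h
  refine le_trans ?_ hk
  obtain ⟨point, hsum, hS, hS'⟩ := exists_points c hAN hBN hA hB
  have hcov z : ∃ i, P i (point z z) ∧ Q i (point z z) :=
    (hf _).1 ((hsum z z).trans (ZModModule.add_self _))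
  choose i hi using hcov
  refine Nat.card_le_card_of_injective i fun y z hyz => ?_
  have hmix : subsetSum c N (point y z) = 0 :=
    (hf _).2 ⟨i y, hP _ _ _ (hS y y z) (hi y).1, hQ _ _ _ (hS' z y z) (hyz ▸ (hi z).2)⟩
  rw [hsum] at hmix
  exact Subtype.ext (sub_eq_zero.1 ((ZModModule.sub_eq_add _ _).trans hmix))

/-- The points that violate the system do not form a rectangle: exchanging the parts of two
points with the sums `z + 0` and `0 + z` gives one with the sum `z + z = 0`. -/
theorem not_rectCover_one_subsetSum_ne_zero {c : ℕ → W} {N : ℕ} {S : Set ℕ} {A B : Finset ℕ}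
    (hAN : A ⊆ Finset.range N) (hBN : B ⊆ Finset.range N)
    (hA : ∀ x ∈ A, x ∈ S) (hB : ∀ x ∈ B, x ∉ S)
    (hne : Submodule.span (ZMod 2) (c '' A) ⊓ Submodule.span (ZMod 2) (c '' B) ≠ ⊥) :
    ¬ RectCover (fun τ => ¬ subsetSum c N τ = 0) S 1 := by
  intro h
  obtain ⟨point, hsum, hS, hS'⟩ := exists_points c hAN hBN hA hB
  obtain ⟨z, hz, hz0⟩ := (Submodule.ne_bot_iff _).1 hne
  lift z to ↥(Submodule.span (ZMod 2) (c '' A) ⊓ Submodule.span (ZMod 2) (c '' B)) using hz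
  exact h.mix (τ := point z 0) (τ' := point 0 z) (by simpa [hsum] using hz0)
    (by simpa [hsum] using hz0) (hS z 0 z) (hS' 0 z z) ((hsum z z).trans (ZModModule.add_self _))

end

/-! ### A matrix whose large column sets have large rank -/

theorem card_span_range_le {n k : ℕ} (g : Fin k → Fin n → ZMod 2) :
    Nat.card ↥(Submodule.span (ZMod 2) (Set.range g)) ≤ 2 ^ k := by
  rw [Module.natCard_eq_pow_finrank (K := ZMod 2), Nat.card_zmod]
  exact Nat.pow_le_pow_right (by norm_num) ((finrank_range_le_card g).trans (by simp))

theorem exists_span_le_span_range {n k : ℕ} (U : Submodule (ZMod 2) (Fin n → ZMod 2))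
    (h : Module.finrank (ZMod 2) U ≤ k) :
    ∃ g : Fin k → Fin n → ZMod 2, U ≤ Submodule.span (ZMod 2) (Set.range g) := by
  let b := Module.finBasis (ZMod 2) U
  refine ⟨fun i => if h : i.1 < Module.finrank (ZMod 2) U then b ⟨i, h⟩ else 0, fun x hx => ?_⟩
  have := (Submodule.mem_map_of_mem (f := U.subtype) (b.mem_span ⟨x, hx⟩))
  rw [Submodule.map_span] at this
  refine Submodule.span_mono ?_ this
  rintro _ ⟨_, ⟨i, rfl⟩, rfl⟩
  exact ⟨⟨i, i.2.trans_le h⟩, by simp⟩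

/-- There are at most `2 ^ (N + n * k + k * s + n * (N - s))` matrices of size `n × N` with `s`
columns of rank at most `k`: choose these columns, `k` generators of a space that contains them,
their values in that space, and the other columns. -/
theorem exists_matrix_forall_lt_rank {J : Type} [Fintype J] {n k s : ℕ}
    (h : Fintype.card J + n * k + k * s < n * s) (hs : s ≤ Fintype.card J) :
    ∃ c : J → Fin n → ZMod 2, ∀ S : Finset J, S.card = s →
      k < Module.finrank (ZMod 2) (Submodule.span (ZMod 2) (c '' S)) := by
  classical
  by_contra! hcon
  let F (p : Finset J × (Fin k → Fin n → ZMod 2)) : Finset (J → Fin n → ZMod 2) :=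
    Fintype.piFinset fun j =>
      if j ∈ p.1 then (Submodule.span (ZMod 2) (Set.range p.2) : Set (Fin n → ZMod 2)).toFinset else Finset.univ
  have hcover : (Finset.univ : Finset (J → Fin n → ZMod 2)) ⊆
      (Finset.powersetCard s Finset.univ ×ˢ Finset.univ).biUnion F := by
    intro c _
    obtain ⟨S, hS, hr⟩ := hcon c
    obtain ⟨g, hg⟩ := exists_span_le_span_range _ hr
    refine Finset.mem_biUnion.2 ⟨(S, g), by simp [hS], Fintype.mem_piFinset.2 fun j => ?_⟩
    by_cases hj : j ∈ S
    · simpa [hj] using hg (Submodule.subset_span ⟨j, hj, rfl⟩)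
    · simp [hj]
  have hF : ∀ p ∈ Finset.powersetCard s (Finset.univ : Finset J) ×ˢ
      (Finset.univ : Finset (Fin k → Fin n → ZMod 2)),
      (F p).card ≤ 2 ^ (k * s + n * (Fintype.card J - s)) := by
    rintro ⟨S, g⟩ hp
    obtain rfl : S.card = s := by simpa using hp
    have hb : ∀ j, (if j ∈ S then (Submodule.span (ZMod 2) (Set.range g) : Set (Fin n → ZMod 2)).toFinset
        else Finset.univ).card ≤ if j ∈ S then 2 ^ k else 2 ^ n := by
      intro j
      split_ifs
      · rw [Set.toFinset_card, ← Nat.card_eq_fintype_card]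
        exact card_span_range_le g
      · simp [ZMod.card]
    refine (Fintype.card_piFinset _).trans_le ((Finset.prod_le_prod' fun j _ => hb j).trans ?_)
    rw [Finset.prod_ite, Finset.prod_const, Finset.prod_const, ← pow_mul, ← pow_mul, ← pow_add,
      Finset.filter_not, Finset.filter_mem_eq_inter, Finset.univ_inter,
      Finset.card_sdiff_of_subset (Finset.subset_univ _), Finset.card_univ]
  have := (Finset.card_le_card hcover).trans (Finset.card_biUnion_le_card_mul _ _ _ hF)
  rw [Finset.card_product, Finset.card_powersetCard, Finset.card_univ, Finset.card_univ,
    Finset.card_univ] at this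
  simp only [Fintype.card_fun, ZMod.card, Fintype.card_fin] at this
  have hle := this.trans (Nat.mul_le_mul_right _ (Nat.mul_le_mul_right _
    (Nat.choose_le_two_pow (Fintype.card J) s)))
  rw [← pow_mul, ← pow_mul, ← pow_add, ← pow_add,
    Nat.pow_le_pow_iff_right (by norm_num)] at hle
  obtain ⟨d, hd⟩ := Nat.exists_eq_add_of_le hs
  rw [hd] at hle h
  rw [Nat.add_sub_cancel_left, Nat.mul_add] at hle
  omega

/-- The columns used for the hard functions. For `n < 64`, all of them are the all-ones vector, and
the vector `1` already gives rank one on both sides. Column `0` is always the all-ones vector, so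
that both values of each of the linear forms are attained on every prefix of the variables. -/
theorem exists_columns {n : ℕ} (hn : 1 ≤ n) {X : Finset ℕ} (hX : X.card = 12 * n) (h0 : 0 ∉ X) :
    ∃ c : ℕ → Fin n → ZMod 2, c 0 = 1 ∧ ∀ A B : Finset ℕ, A ⊆ X → B ⊆ X →
      4 * n ≤ A.card → 4 * n ≤ B.card → 2 ^ (n / 64 + 1) ≤
        Nat.card ↥(Submodule.span (ZMod 2) (c '' A) ⊓ Submodule.span (ZMod 2) (c '' B)) := by
  suffices ∃ c : ℕ → Fin n → ZMod 2, c 0 = 1 ∧ ∀ A B : Finset ℕ, A ⊆ X → B ⊆ X →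
      4 * n ≤ A.card → 4 * n ≤ B.card → n / 64 + 1 ≤ Module.finrank (ZMod 2)
        ↥(Submodule.span (ZMod 2) (c '' A) ⊓ Submodule.span (ZMod 2) (c '' B)) by
    obtain ⟨c, hc, h⟩ := this
    refine ⟨c, hc, fun A B hA hB hA' hB' => ?_⟩
    rw [Module.natCard_eq_pow_finrank (K := ZMod 2), Nat.card_zmod]
    exact Nat.pow_le_pow_right (by norm_num) (h A B hA hB hA' hB')
  rcases lt_or_ge n 64 with h64 | h64
  · refine ⟨fun _ => 1, rfl, fun A B _ _ hA hB => ?_⟩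
    rw [Nat.div_eq_of_lt h64, zero_add, Submodule.one_le_finrank_iff, Submodule.ne_bot_iff]
    have hmem (A : Finset ℕ) (hA : 4 * n ≤ A.card) : (1 : Fin n → ZMod 2) ∈
        Submodule.span (ZMod 2) ((fun _ => 1 : ℕ → Fin n → ZMod 2) '' A) := by
      obtain ⟨a, ha⟩ : A.Nonempty := Finset.card_pos.1 (by omega)
      exact Submodule.subset_span ⟨a, ha, rfl⟩
    exact ⟨1, ⟨hmem A hA, hmem B hB⟩, fun h => by simpa using congrFun h ⟨0, hn⟩⟩
  · obtain ⟨c, hc⟩ := exists_matrix_forall_lt_rank (J := X) (n := n) (k := 3 * n / 4) (s := 4 * n)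
      (by
        rw [Fintype.card_coe, hX]
        -- Divided by `n`, the inequality reads `12 + 5 * k < 4 * n`, where `k ≤ 3 * n / 4`.
        have hk : 12 * n + n * (3 * n / 4) + 3 * n / 4 * (4 * n) = n * (12 + 5 * (3 * n / 4)) := by
          ring
        rw [hk]
        exact Nat.mul_lt_mul_of_pos_left (by omega) (by omega))
      (by rw [Fintype.card_coe, hX]; omega)
    refine ⟨fun j => if h : j ∈ X then c ⟨j, h⟩ else 1, by simp [h0], fun A B hA hB hA' hB' => ?_⟩
    set c' : ℕ → Fin n → ZMod 2 := fun j => if h : j ∈ X then c ⟨j, h⟩ else 1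
    have hr (A : Finset ℕ) (hA : A ⊆ X) (hA' : 4 * n ≤ A.card) :
        3 * n / 4 < Module.finrank (ZMod 2) (Submodule.span (ZMod 2) (c' '' A)) := by
      obtain ⟨S, hS, hcard⟩ := Finset.exists_subset_card_eq hA'
      have hSX := hS.trans hA
      refine (hc (S.subtype (· ∈ X)) ?_).trans_le (Submodule.finrank_mono (Submodule.span_mono ?_))
      · rw [Finset.card_subtype, Finset.filter_true_of_mem fun x hx => hSX hx, hcard]
      · rintro _ ⟨⟨j, hj⟩, hjS, rfl⟩
        exact ⟨j, hS (by simpa using hjS), by simp [c', hj]⟩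
    have h1 := Submodule.finrank_sup_add_finrank_inf_eq (Submodule.span (ZMod 2) (c' '' A))
      (Submodule.span (ZMod 2) (c' '' B))
    have h2 := Submodule.finrank_le (Submodule.span (ZMod 2) (c' '' A) ⊔
      Submodule.span (ZMod 2) (c' '' B))
    rw [Module.finrank_fin_fun] at h2
    have h3 := hr A hA hA'
    have h4 := hr B hB hB'
    omega

/-! ### The circuits -/

/-- The automaton that guesses one of the linear forms `∑ k, c k i * τ k` over `𝔽₂`, where
`k ≤ M + 1`, and accepts if it has the value `b`; a state consists of the guessed form and the
value of the prefix read so far. The coefficient of variable `0` is taken to be `1`. -/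
def parityAutomaton {ι : Type} [Nonempty ι] (c : ℕ → ι → ZMod 2) (M : ℕ) (b : ZMod 2) :
    LayeredAutomaton (ι × ZMod 2) where
  init p := decide (p.2 = 1)
  step j p v p' := p.1 = p'.1 ∧ p.2 + (if v then c (j + 1) p.1 else 0) = p'.2
  accept p v := p.2 + (if v then c (M + 1) p.1 else 0) = b
  exists_step _ p' := ⟨p', false, by simp⟩
  exists_accept := ⟨(Classical.arbitrary ι, b), false, by simp⟩

section

variable {ι : Type} [Nonempty ι] {c : ℕ → ι → ZMod 2} (M : ℕ) (b : ZMod 2)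

theorem reach_parityAutomaton (hc : c 0 = 1) (τ : ℕ → Bool) (j : ℕ) (p : ι × ZMod 2) :
    (parityAutomaton c M b).Reach τ j p ↔ subsetSum (fun k => c k p.1) (j + 1) τ = p.2 := by
  induction j generalizing p with
  | zero =>
    have h2 : ∀ x : ZMod 2, x = 0 ∨ x = 1 := by decide
    rcases h2 p.2 with h | h <;> cases h' : τ 0 <;>
      simp [LayeredAutomaton.Reach, parityAutomaton, subsetSum, hc, h, h']
  | succ j ih =>
    rw [subsetSum_succ]
    constructor
    · rintro ⟨q, ⟨h1, h2⟩, h3⟩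
      rw [ih] at h3
      rw [← h2, ← h1, h3]
    · intro h
      exact ⟨(p.1, subsetSum (fun k => c k p.1) (j + 1) τ), ⟨rfl, h⟩, (ih _).2 rfl⟩

theorem eval_parityAutomaton [Finite ι] (hc : c 0 = 1) (τ : ℕ → Bool) :
    ((parityAutomaton c M b).toDNNF M).Eval τ ↔
      ∃ i, subsetSum (fun k => c k i) (M + 2) τ = b := by
  simp only [LayeredAutomaton.eval_toDNNF, reach_parityAutomaton M b hc, Prod.exists,
    subsetSum_succ _ (M + 1)]
  exact exists_congr fun i => ⟨fun ⟨x, h1, h2⟩ => h2 ▸ h1, fun h => ⟨_, h, rfl⟩⟩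

theorem deterministic_parityAutomaton [Finite ι] [Subsingleton ι] (hc : c 0 = 1) :
    ((parityAutomaton c M b).toDNNF M).Deterministic := by
  refine LayeredAutomaton.deterministic_toDNNF _ fun τ j p q hp hq => ?_
  rw [reach_parityAutomaton M b hc] at hp hq
  have := Subsingleton.elim p.1 q.1
  exact Prod.ext this (by rw [← hp, ← hq, this])

theorem width_parityAutomaton [Finite ι] {M : ℕ} (hM : 1 ≤ M) :
    ((parityAutomaton c M b).toDNNF M).width = Nat.card ι * 2 := by
  rw [LayeredAutomaton.width_toDNNF _ hM, Nat.card_prod, Nat.card_zmod]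

end

/-- The automaton that guesses one of the assignments in `F` and compares it with the input. -/
def assignmentAutomaton (F : Set (ℕ → Bool)) [Nonempty F] (M : ℕ) : LayeredAutomaton F where
  init α := α.1 0
  step j α v α' := α = α' ∧ v = α.1 (j + 1)
  accept α v := v = α.1 (M + 1)
  exists_step _ α := ⟨α, _, rfl, rfl⟩
  exists_accept := ⟨Classical.arbitrary F, _, rfl⟩

theorem reach_assignmentAutomaton (F : Set (ℕ → Bool)) [Nonempty F] (M : ℕ) (τ : ℕ → Bool)
    (j : ℕ) (α : F) :
    (assignmentAutomaton F M).Reach τ j α ↔ ∀ k < j + 1, τ k = α.1 k := by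
  induction j generalizing α with
  | zero => simp [LayeredAutomaton.Reach, assignmentAutomaton]
  | succ j ih =>
    rw [Nat.forall_lt_succ_right]
    constructor
    · rintro ⟨_, ⟨rfl, h2⟩, h3⟩
      exact ⟨(ih _).1 h3, h2⟩
    · exact fun h => ⟨α, ⟨rfl, h.2⟩, (ih _).2 h.1⟩

theorem eval_assignmentAutomaton (F : Set (ℕ → Bool)) [Nonempty F] [Finite F] (M : ℕ)
    (τ : ℕ → Bool) :
    ((assignmentAutomaton F M).toDNNF M).Eval τ ↔ ∃ α ∈ F, ∀ k < M + 2, τ k = α k := by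
  simp only [LayeredAutomaton.eval_toDNNF, reach_assignmentAutomaton, Subtype.exists,
    Nat.forall_lt_succ_right (n := M + 1)]
  exact exists_congr fun α => ⟨fun ⟨h, h1, h2⟩ => ⟨h, h2, h1⟩, fun ⟨h, h2, h1⟩ => ⟨h, h1, h2⟩⟩

/-- Every satisfiable function of finitely many variables is computed by a complete structured
DNNF. -/
theorem exists_representableWithWidth {f : (ℕ → Bool) → Prop} {M : ℕ}
    (hf : ∀ τ τ', (∀ k < M + 2, τ k = τ' k) → f τ → f τ') (hsat : ∃ τ, f τ) :
    ∃ w, RepresentableWithWidth f w := by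
  let F : Set (ℕ → Bool) := {α | f α ∧ ∀ k, M + 2 ≤ k → α k = false}
  have hF : ∀ τ, f τ → (fun k => if k < M + 2 then τ k else false) ∈ F := fun τ h =>
    ⟨hf τ _ (fun k hk => by simp [hk]) h, fun k hk => by simp [not_lt.2 hk]⟩
  have : Nonempty F := hsat.elim fun τ h => ⟨⟨_, hF τ h⟩⟩
  have : Finite F := by
    refine Finite.of_injective (fun (α : F) (k : Fin (M + 2)) => α.1 k) fun α β h => ?_
    refine Subtype.ext (funext fun k => ?_)
    rcases lt_or_ge k (M + 2) with hk | hk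
    · exact congrFun h ⟨k, hk⟩
    · rw [α.2.2 k hk, β.2.2 k hk]
  refine ⟨_, _, _, linearVTree_isVTreeFor (M + 1), (assignmentAutomaton F M).toDNNF M, fun τ => ?_,
    rfl⟩
  rw [eval_assignmentAutomaton]
  constructor
  · rintro ⟨α, hα, h⟩
    exact hf α τ (fun k hk => (h k hk).symm) hα.1
  · exact fun h => ⟨_, hF τ h, fun k hk => by simp [hk]⟩

/-! ### The hard family -/

/-- Here `f` says that `n` linear forms in `12 * n + 1` variables vanish, `D b i` tests whether the
`i`-th form has the value `b`, and `E` guesses a form that does not vanish. -/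
theorem exists_hard_family {n : ℕ} (hn : 1 ≤ n) :
    ∃ (X : Finset ℕ) (T : VTree ℕ) (D : ZMod 2 → Fin n → CompleteStructuredDNNF T)
      (E : CompleteStructuredDNNF T) (f : (ℕ → Bool) → Prop),
      T.IsVTreeFor X ∧ X.card ≤ 13 * n ∧ (∀ b i, (D b i).Deterministic ∧ (D b i).width = 2) ∧
      (∀ τ, (∀ i, (D 0 i).Eval τ) ↔ f τ) ∧ (∀ τ, (∃ i, (D 1 i).Eval τ) ↔ ¬ f τ) ∧
      (∀ τ, E.Eval τ ↔ ¬ f τ) ∧ E.width = 2 * n ∧ (∃ w, RepresentableWithWidth f w) ∧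
      (∀ w, RepresentableWithWidth f w → 2 ^ (n / 64 + 1) ≤ w) ∧
      ∀ w, RepresentableWithWidth (fun τ => ¬ f τ) w → n / 64 + 1 ≤ w := by
  obtain ⟨M, hM⟩ : ∃ M, M + 1 = 12 * n := ⟨12 * n - 1, by omega⟩
  have : Nonempty (Fin n) := ⟨⟨0, hn⟩⟩
  set X := Finset.Icc 1 (M + 1) with hX
  have hXcard : X.card = 12 * n := by simp [hX, hM]
  have hXN : X ⊆ Finset.range (M + 2) := fun x hx => by
    rw [hX, Finset.mem_Icc] at hx
    exact Finset.mem_range.2 (by omega)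
  obtain ⟨c, hc0, hc⟩ := exists_columns hn hXcard (by simp [hX])
  have happ (τ : ℕ → Bool) (i : Fin n) :
      subsetSum (fun k => c k i) (M + 2) τ = subsetSum c (M + 2) τ i := by
    simp only [subsetSum, Finset.sum_apply]
    exact Finset.sum_congr rfl fun k _ => by split_ifs <;> rfl
  have hD (b : ZMod 2) (i : Fin n) (τ : ℕ → Bool) :
      ((parityAutomaton (fun k (_ : Unit) => c k i) M b).toDNNF M).Eval τ ↔
        subsetSum c (M + 2) τ i = b := by
    rw [eval_parityAutomaton M b (by simp only [hc0]; rfl), ← happ]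
    simp
  have hE (τ : ℕ → Bool) :
      (∃ i, subsetSum c (M + 2) τ i = 1) ↔ ¬ subsetSum c (M + 2) τ = 0 := by
    have h2 : ∀ x : ZMod 2, x = 1 ↔ x ≠ 0 := by decide
    rw [funext_iff, not_forall]
    exact exists_congr fun i => h2 _
  have hU {A B : Finset ℕ} (hA : A ⊆ X) (hB : B ⊆ X) (hA' : 4 * n ≤ A.card)
      (hB' : 4 * n ≤ B.card) :
      Submodule.span (ZMod 2) (c '' A) ⊓ Submodule.span (ZMod 2) (c '' B) ≠ ⊥ := by
    intro h
    have := hc A B hA hB hA' hB'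
    rw [h, Nat.card_unique, pow_succ] at this
    have := Nat.one_le_two_pow (n := n / 64)
    omega
  refine ⟨Finset.range (M + 2), linearVTree (M + 1),
    fun b i => (parityAutomaton (fun k (_ : Unit) => c k i) M b).toDNNF M,
    (parityAutomaton c M 1).toDNNF M, fun τ => subsetSum c (M + 2) τ = 0,
    linearVTree_isVTreeFor _, ?_, fun b i => ⟨?_, ?_⟩, fun τ => ?_, fun τ => ?_, fun τ => ?_, ?_,
    ?_, ?_, ?_⟩
  · rw [Finset.card_range]
    omega
  · exact deterministic_parityAutomaton M b (by simp only [hc0]; rfl)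
  · rw [width_parityAutomaton b (by omega), Nat.card_unique]
  · simp only [hD]
    exact funext_iff.symm
  · simp only [hD]
    exact hE τ
  · rw [eval_parityAutomaton M 1 hc0, ← hE]
    simp only [happ]
  · rw [width_parityAutomaton 1 (by omega), Nat.card_fin, mul_comm]
  · refine exists_representableWithWidth (M := M) (fun τ τ' h hτ => ?_) ⟨fun _ => false, ?_⟩
    · rw [← hτ]
      exact Finset.sum_congr rfl fun k hk => by rw [h k (Finset.mem_range.1 hk)]
    · simp [subsetSum]
  · refine fun w => le_width_of_forall_rectCover (X := X) (s := 4 * n) (by omega) (by omega)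
      (Nat.le_self_pow (by omega) 2) fun S A B hA hB hAS hBS hA' hB' k hk => ?_
    exact (hc A B hA hB hA' hB').trans
      (card_inf_span_le_of_rectCover (hA.trans hXN) (hB.trans hXN) hAS hBS hk)
  · refine fun w hw => (le_max_right 2 _).trans (le_width_of_forall_rectCover (X := X)
      (s := 4 * n) (by omega) (by omega) (le_max_left _ _)
      (fun S A B hA hB hAS hBS hA' hB' k hk => max_le ?_ ?_) hw)
    · by_contra! hk1
      exact not_rectCover_one_subsetSum_ne_zero (hA.trans hXN) (hB.trans hXN) hAS hBS
        (hU hA hB hA' hB') (hk.mono (by omega))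
    · have hk' := hk.compl
      simp only [not_not] at hk'
      exact (Nat.pow_le_pow_iff_right (by norm_num)).1 ((hc A B hA hB hA' hB').trans
        (card_inf_span_le_of_rectCover (hA.trans hXN) (hB.trans hXN) hAS hBS hk'))

/-- A conjunction of literals has width `1`, but its negation needs width `2`: across a partition
that splits the variables, a disjunction of literals is not a rectangle. -/
theorem exists_width_one_negation_hard :
    ∃ (X : Finset ℕ) (T : VTree ℕ) (E : CompleteStructuredDNNF T), T.IsVTreeFor X ∧ E.width = 1 ∧
      (∃ w, RepresentableWithWidth (fun τ => ¬ E.Eval τ) w) ∧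
      ∀ w, RepresentableWithWidth (fun τ => ¬ E.Eval τ) w → 2 ≤ w := by
  let E := (assignmentAutomaton {fun _ => true} 4).toDNNF 4
  have hE (τ : ℕ → Bool) : E.Eval τ ↔ ∀ k < 6, τ k = true :=
    (eval_assignmentAutomaton _ _ _).trans (by simp)
  refine ⟨_, _, E, linearVTree_isVTreeFor 5, ?_, ?_, fun w => ?_⟩
  · rw [LayeredAutomaton.width_toDNNF _ (by norm_num), Nat.card_unique]
  · refine exists_representableWithWidth (M := 4) (fun τ τ' h hτ => ?_) ⟨fun _ => false, ?_⟩
    · rw [hE] at hτ ⊢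
      exact fun h' => hτ fun k hk => (h k hk).trans (h' k hk)
    · rw [hE]
      exact fun h => by simpa using h 0
  · refine le_width_of_forall_rectCover (X := Finset.range 6) (s := 2) le_rfl (by simp) le_rfl
      fun S A B hA hB hAS hBS hA' hB' k hk => ?_
    by_contra! hk1
    obtain ⟨a, ha⟩ : A.Nonempty := Finset.card_pos.1 (by omega)
    obtain ⟨b, hb⟩ : B.Nonempty := Finset.card_pos.1 (by omega)
    have hpt (x : ℕ) (hx : x ∈ Finset.range 6) : ¬ E.Eval (fun k => decide (k ≠ x)) := by
      rw [hE]
      exact fun h => by simpa using h x (Finset.mem_range.1 hx)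
    refine (hk.mono (Nat.le_of_lt_succ hk1)).mix (ρ := fun _ => true) (hpt b (hB hb))
      (hpt a (hA ha)) (fun x hx => ?_) (fun x hx => ?_) ((hE _).2 fun _ _ => rfl)
    · exact decide_eq_true fun h => hBS b hb (h ▸ hx)
    · exact decide_eq_true fun h => hx (h ▸ hAS a ha)

/-! ### Asymptotic form of the bounds -/

theorem two_rpow_le_of_two_pow_le {n w : ℕ} {x : ℝ} (hx : x ≤ n / 64) (h : 2 ^ (n / 64 + 1) ≤ w) :
    (2 : ℝ) ^ x ≤ w := by
  have h1 : (n : ℝ) / 64 ≤ (n / 64 + 1 : ℕ) := by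
    rw [div_le_iff₀ (by norm_num)]
    exact_mod_cast (by omega : n ≤ (n / 64 + 1) * 64)
  calc (2 : ℝ) ^ x ≤ 2 ^ (((n / 64 + 1 : ℕ)) : ℝ) :=
        Real.rpow_le_rpow_of_exponent_le (by norm_num) (hx.trans h1)
    _ ≤ w := by rw [Real.rpow_natCast]; exact_mod_cast h

theorem mainTheorem5 :
    -- the family
    (∃ C ε : ℝ, 0 < ε ∧ ∀ n : ℕ, 1 ≤ n →
      ∃ (X : Finset ℕ) (T : VTree ℕ) (D : Fin n → CompleteStructuredDNNF T),
        T.IsVTreeFor X ∧ (X.card : ℝ) ≤ C * n ∧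
        (∀ i, (D i).Deterministic ∧ (D i).width = 2) ∧
        (∃ w : ℕ, RepresentableWithWidth (fun τ => ∀ i, (D i).Eval τ) w) ∧
        (∀ w : ℕ, RepresentableWithWidth (fun τ => ∀ i, (D i).Eval τ) w →
          (2 : ℝ) ^ (ε * n) ≤ w) ∧
        (∃ E : CompleteStructuredDNNF T,
          E.Computes (fun τ => ∃ i, ¬ (D i).Eval τ) ∧ (E.width : ℝ) ≤ C * n) ∧
        (∀ w : ℕ, RepresentableWithWidth (fun τ => ∃ i, ¬ (D i).Eval τ) w → ε * n ≤ w)) ∧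
    -- the upper bound `2 ^ w` for negation is optimal up to a constant factor in the exponent
    (∃ δ : ℝ, 0 < δ ∧ ∀ w : ℕ, 1 ≤ w →
      ∃ (X : Finset ℕ) (T : VTree ℕ) (E : CompleteStructuredDNNF T),
        T.IsVTreeFor X ∧ E.width ≤ w ∧
        (∃ w' : ℕ, RepresentableWithWidth (fun τ => ¬ E.Eval τ) w') ∧
        (∀ w' : ℕ, RepresentableWithWidth (fun τ => ¬ E.Eval τ) w' → (2 : ℝ) ^ (δ * w) ≤ w')) ∧
    -- unbounded conjunction is not width-bounded
    (∃ B : ℕ, ∀ K : ℕ, ∃ (n : ℕ) (X : Finset ℕ) (T : VTree ℕ)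
      (D : Fin n → CompleteStructuredDNNF T),
        T.IsVTreeFor X ∧ (∀ i, (D i).Deterministic ∧ (D i).width ≤ B) ∧
        (∃ w : ℕ, RepresentableWithWidth (fun τ => ∀ i, (D i).Eval τ) w) ∧
        (∀ w : ℕ, RepresentableWithWidth (fun τ => ∀ i, (D i).Eval τ) w → K < w)) ∧
    -- unbounded disjunction is not width-bounded
    (∃ B : ℕ, ∀ K : ℕ, ∃ (n : ℕ) (X : Finset ℕ) (T : VTree ℕ)
      (D : Fin n → CompleteStructuredDNNF T),
        T.IsVTreeFor X ∧ (∀ i, (D i).Deterministic ∧ (D i).width ≤ B) ∧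
        (∃ w : ℕ, RepresentableWithWidth (fun τ => ∃ i, (D i).Eval τ) w) ∧
        (∀ w : ℕ, RepresentableWithWidth (fun τ => ∃ i, (D i).Eval τ) w → K < w)) := by
  refine ⟨⟨13, 1 / 64, by norm_num, fun n hn => ?_⟩, ⟨1 / 256, by norm_num, fun w hw => ?_⟩,
    ⟨2, fun K => ?_⟩, ⟨2, fun K => ?_⟩⟩
  · obtain ⟨X, T, D, E, f, hT, hX, hD, hand, -, hE, hEw, hex, hlow, hlow'⟩ := exists_hard_family hn
    have hor : (fun τ => ∃ i, ¬ (D 0 i).Eval τ) = fun τ => ¬ f τ :=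
      funext fun τ => propext (by rw [← hand, not_forall])
    refine ⟨X, T, D 0, hT, by exact_mod_cast hX, hD 0, ?_⟩
    rw [hor]
    simp only [hand]
    refine ⟨hex, fun w hw => two_rpow_le_of_two_pow_le (by linarith) (hlow w hw), ⟨E, hE, ?_⟩,
      fun w hw => ?_⟩
    · rw [hEw]
      exact_mod_cast (by omega : 2 * n ≤ 13 * n)
    · have h1 := hlow' w hw
      have h2 : (n : ℝ) ≤ 64 * w := by exact_mod_cast (by omega : n ≤ 64 * w)
      linarith
  · rcases lt_or_ge w 2 with hw2 | hw2
    · obtain ⟨X, T, E, hT, hE, hex, hlow⟩ := exists_width_one_negation_hard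
      obtain rfl : w = 1 := by omega
      exact ⟨X, T, E, hT, hE.le, hex, fun w' hw' =>
        two_rpow_le_of_two_pow_le (n := 1) (by norm_num) (by simpa using hlow w' hw')⟩
    · obtain ⟨X, T, D, E, f, hT, -, -, -, -, hE, hEw, hex, hlow, -⟩ :=
        exists_hard_family (n := w / 2) (by omega)
      refine ⟨X, T, E, hT, by omega, ?_⟩
      simp only [hE, not_not]
      refine ⟨hex, fun w' hw' => two_rpow_le_of_two_pow_le ?_ (hlow w' hw')⟩
      have : (w : ℝ) ≤ 4 * (w / 2 : ℕ) := by exact_mod_cast (by omega : w ≤ 4 * (w / 2))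
      linarith
  · obtain ⟨X, T, D, E, f, hT, -, hD, hand, -, -, -, hex, hlow, -⟩ :=
      exists_hard_family (n := 64 * (K + 1)) (by omega)
    refine ⟨_, X, T, D 0, hT, fun i => ⟨(hD 0 i).1, (hD 0 i).2.le⟩, ?_⟩
    simp only [hand]
    refine ⟨hex, fun w hw => ?_⟩
    have h1 := hlow w hw
    have h2 := Nat.lt_two_pow_self (n := 64 * (K + 1) / 64 + 1)
    omega
  · obtain ⟨X, T, D, E, f, hT, -, hD, -, hor, hE, -, -, -, hlow⟩ :=
      exists_hard_family (n := 64 * (K + 1)) (by omega)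
    refine ⟨_, X, T, D 1, hT, fun i => ⟨(hD 1 i).1, (hD 1 i).2.le⟩, ?_⟩
    simp only [hor]
    refine ⟨⟨_, X, T, hT, E, hE, rfl⟩, fun w hw => ?_⟩
    have := hlow w hw
    omega
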